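/- Let $k,l\ge 1$ be integers, $\lambda_1,\dots,\lambda_l>0$, $\mu>0$, and put $\lambda=\lambda_1+\dots+\lambda_l$, $c_m=\lambda_m/\lambda$. Let $\{\mathcal Q(t)\}_{t\ge 0}=\{(\mathcal N(t),\mathcal S(t))\}_{t\ge0}$ be the state-phase process of the Erlang queue with multiple arrivals, i.e. a Markov process with values in $\{(0,0)\}\cup\{(n,s): n\ge 1,\ 1\le s\le k\}$, with $\mathcal Q(0)=(0,0)$, such that as $h\downarrow0$, up to errors $o(h)$ that are uniform in the time $t\ge 0$, the conditional probability, given the state at time $t$, that in $(t,t+h]$ the process - makes the transition $(0,0)\to(m,k)$, or $(n,s)\to(n+m,s)$ with $n\ge1$, is $\lambda c_m h$ for each $1\le m\le l$ (arrival of $m$ customers); - makes the transition $(n,s)\to(n,s-1)$ for $n\ge 1$, $2\le s\le k$; $(n,1)\to(n-1,k)$ for $n\ge2$; or $(1,1)\to(0,0)$, is $k\mu h$ (completion of one of the $k$ service phases); - is in the same state at time $t+h$ is $1-\lambda h$ if that state is $(0,0)$, and $1-(\lambda+k\mu)h$ otherwise; and transitions to all other states have probability $o(h)$. Let $p_0(t)=\Pr(\mathcal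 Q(t)=(0,0)\mid\mathcal Q(0)=(0,0))$ and $p_{n,s}(t)=\Pr(\mathcal Q(t)=(n,s)\mid\mathcal Q(0)=(0,0))$. Then, for every complex $x$ with $|x|\le 1$ and every $t\ge 0$, the series $$G(x,t)=p_0(t)+\sum_{n=1}^\infty\sum_{s=1}^k x^{(n-1)k+s}\,p_{n,s}(t)$$ converges, $G(x,\cdot)$ is differentiable on $[0,\infty)$ (one-sidedly at $0$), and $$x\,\frac{\partial}{\partial t}G(x,t)=\Big(k\mu(1-x)-\lambda x\Big(1-\sum_{m=1}^{l}c_m x^{mk}\Big)\Big)G(x,t)-k\mu(1-x)\,p_0(t),$$ with initial condition $G(x,0)=1$. -/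

import Mathlib

open MeasureTheory ProbabilityTheory

namespace ErlangQueue

/-- The state space of the state-phase process: `(0,0)` is the empty system, and `(n,s)` with
`n ≥ 1` and `1 ≤ s ≤ k` means that `n` customers are present and the one being served is in
phase `s`. Phases are passed in the order `k, k-1, …, 1`. -/
def states (k : ℕ) : Set (ℕ × ℕ) :=
  {a | a = (0, 0) ∨ (1 ≤ a.1 ∧ 1 ≤ a.2 ∧ a.2 ≤ k)}

/-- State after a group of `m ≥ 1` customers has arrived: if the system was empty, one of them
enters service in phase `k`; otherwise the phase of the customer in service is unchanged. -/
def afterArrival (k : ℕ) (a : ℕ × ℕ) (m : ℕ) : ℕ × ℕ :=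
  if a.1 = 0 then (m, k) else (a.1 + m, a.2)

/-- State after the current service phase has been completed (for a nonempty system): the phase
drops by one; if it was the last phase, the customer leaves, and the next customer, if there is
one, starts in phase `k`. -/
def afterPhase (k : ℕ) (a : ℕ × ℕ) : ℕ × ℕ :=
  if a.2 = 1 then (if a.1 = 1 then (0, 0) else (a.1 - 1, k)) else (a.1, a.2 - 1)

/-- Total arrival rate `λ = λ₁ + ⋯ + λ_l`. -/
noncomputable def totalRate (l : ℕ) (lam : ℕ → ℝ) : ℝ := ∑ m ∈ Finset.Icc 1 l, lam m

/-- `c_m = λ_m / λ`. -/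
noncomputable def c (l : ℕ) (lam : ℕ → ℝ) (m : ℕ) : ℝ := lam m / totalRate l lam

/-- Infinitesimal transition rates: groups of size `m ∈ {1, …, l}` arrive at rate `λ c_m = λ_m`,
and, when the system is not empty, the current phase is completed at rate `k μ`. The diagonal
entry is minus the total rate of leaving the state. -/
noncomputable def rate (k l : ℕ) (lam : ℕ → ℝ) (μ : ℝ) (a b : ℕ × ℕ) : ℝ :=
  if b = a then -(totalRate l lam + if a.1 = 0 then 0 else (k : ℝ) * μ)
  else (∑ m ∈ Finset.Icc 1 l, if b = afterArrival k a m then totalRate l lam * c l lam m else 0)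
    + if a.1 ≠ 0 ∧ b = afterPhase k a then (k : ℝ) * μ else 0

/-- `Q` is (the state-phase process of) an Erlang queue with multiple arrivals, under the
probability measure `P`: a Markov process in `states k`, started in the empty system, with
`P(Q(t+h) = b | Q(t) = a) = 1_{a = b} + rate(a,b) h + o(h)` as `h ↓ 0`, where the `o(h)` does not
depend on `t`. Only the times `t ≥ 0` matter. -/
structure IsErlangQueue {Ω : Type*} [MeasurableSpace Ω] (P : Measure Ω)
    (k l : ℕ) (lam : ℕ → ℝ) (μ : ℝ) (Q : ℝ → Ω → ℕ × ℕ) : Prop where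
  measurable : ∀ t, 0 ≤ t → Measurable (Q t)
  mem_states : ∀ t, 0 ≤ t → ∀ᵐ ω ∂P, Q t ω ∈ states k
  start : ∀ᵐ ω ∂P, Q 0 ω = (0, 0)
  /-- Markov property: conditionally on the present, any finite part of the past is irrelevant. -/
  markov : ∀ (t h : ℝ), 0 ≤ t → 0 ≤ h → ∀ (I : Finset ℝ), (∀ u ∈ I, 0 ≤ u ∧ u ≤ t) →
    ∀ (e : ℝ → ℕ × ℕ) (a b : ℕ × ℕ),
      P (Q t ⁻¹' {a} ∩ ⋂ u ∈ I, Q u ⁻¹' {e u}) ≠ 0 →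
      cond P (Q t ⁻¹' {a} ∩ ⋂ u ∈ I, Q u ⁻¹' {e u}) (Q (t + h) ⁻¹' {b})
        = cond P (Q t ⁻¹' {a}) (Q (t + h) ⁻¹' {b})
  /-- Infinitesimal transition probabilities. -/
  infinitesimal : ∀ a ∈ states k, ∀ b ∈ states k, ∀ ε : ℝ, 0 < ε → ∃ δ : ℝ, 0 < δ ∧
    ∀ t h : ℝ, 0 ≤ t → 0 < h → h < δ → P (Q t ⁻¹' {a}) ≠ 0 →
      |(cond P (Q t ⁻¹' {a})).real (Q (t + h) ⁻¹' {b})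
        - ((if b = a then 1 else 0) + rate k l lam μ a b * h)| ≤ ε * h

/-- Transient state-phase probabilities `P(Q(t) = a | Q(0) = (0,0))`. -/
noncomputable def prob {Ω : Type*} [MeasurableSpace Ω] (P : Measure Ω) (Q : ℝ → Ω → ℕ × ℕ)
    (a : ℕ × ℕ) (t : ℝ) : ℝ :=
  (cond P (Q 0 ⁻¹' {(0, 0)})).real (Q t ⁻¹' {a})

/-- The `n`-th term, `n ≥ 0`, of the series in `genFun`; it collects the states with `n + 1`
customers. -/
noncomputable def genTerm {Ω : Type*} [MeasurableSpace Ω] (P : Measure Ω) (k : ℕ)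
    (Q : ℝ → Ω → ℕ × ℕ) (x : ℂ) (t : ℝ) (n : ℕ) : ℂ :=
  ∑ s ∈ Finset.Icc 1 k, x ^ (n * k + s) * (prob P Q (n + 1, s) t : ℂ)

/-- `G(x,t) = p₀(t) + ∑_{n ≥ 1} ∑_{s=1}^k x^{(n-1)k+s} p_{n,s}(t)`. -/
noncomputable def genFun {Ω : Type*} [MeasurableSpace Ω] (P : Measure Ω) (k : ℕ)
    (Q : ℝ → Ω → ℕ × ℕ) (x : ℂ) (t : ℝ) : ℂ :=
  (prob P Q (0, 0) t : ℂ) + ∑' n : ℕ, genTerm P k Q x t n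

end ErlangQueue

namespace ErlangQueue

open Filter Topology

/-! The exponent `(n-1)k+s` counts the service phases still owed in state `(n,s)`, so `G(x,t)` is
the expectation of the bounded function `monomial k x` of `Q t`. For every bounded `φ`, Kolmogorov's
forward equation `d/dt E φ(Q t) = E (Lφ)(Q t)` holds with `L` the generator
(`hasDerivWithinAt_integral`). The theorem follows by computing `x · L(monomial k x)` state by state
(`mul_generator_monomial`).

The difficulty is exchanging the derivative with the infinite sum over states, since the `o(h)` in
the hypothesis may depend on the states. The Markov property repairs this: cutting `[t, t+h]` into
short steps shows that any state is left within time `h` with probability at most `h` times one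
common rate (`stay_ge`, `leave_le`). This bound dominates the difference quotients and makes `E φ(Q
t)` Lipschitz in `t`. Dominated convergence gives the right derivative, and its continuity makes it
a derivative on `[0,∞)`. -/

lemma totalRate_pos {l : ℕ} {lam : ℕ → ℝ} (hl : 1 ≤ l) (hlam : ∀ m, 1 ≤ m → m ≤ l → 0 < lam m) :
    0 < totalRate l lam :=
  Finset.sum_pos (fun m hm => hlam m (Finset.mem_Icc.1 hm).1 (Finset.mem_Icc.1 hm).2)
    ⟨1, Finset.mem_Icc.2 ⟨le_rfl, hl⟩⟩

lemma sum_totalRate_mul_c {l : ℕ} {lam : ℕ → ℝ} (h : totalRate l lam ≠ 0) :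
    ∑ m ∈ Finset.Icc 1 l, totalRate l lam * c l lam m = totalRate l lam := by
  have : ∀ m, totalRate l lam * c l lam m = lam m := fun m => by
    unfold c; field_simp
  exact Finset.sum_congr rfl fun m _ => this m

/-! ### Transitions, generator and its action on monomials -/

lemma afterArrival_ne {k : ℕ} (a : ℕ × ℕ) {m : ℕ} (hm : 1 ≤ m) : a ≠ afterArrival k a m := by
  intro h
  have := congrArg Prod.fst h
  unfold afterArrival at this
  split_ifs at this <;> grind

lemma afterPhase_ne {k : ℕ} {a : ℕ × ℕ} (ha : a ∈ states k) (h0 : a.1 ≠ 0) :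
    a ≠ afterPhase k a := by
  obtain ⟨n, s⟩ := a
  simp only [states, Set.mem_ofPred_eq, Prod.mk.injEq] at ha h0
  intro h
  simp only [afterPhase] at h
  split_ifs at h <;> simp only [Prod.mk.injEq] at h <;> omega

lemma afterArrival_mem {k : ℕ} (hk : 1 ≤ k) {a : ℕ × ℕ} (ha : a ∈ states k) {m : ℕ} (hm : 1 ≤ m) :
    afterArrival k a m ∈ states k := by
  obtain ⟨n, s⟩ := a
  simp only [states, Set.mem_ofPred_eq, Prod.mk.injEq, afterArrival] at ha ⊢
  split_ifs <;> simp only [Prod.mk.injEq] <;> omega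

lemma afterPhase_mem {k : ℕ} (hk : 1 ≤ k) {a : ℕ × ℕ} (ha : a ∈ states k) :
    afterPhase k a ∈ states k := by
  obtain ⟨n, s⟩ := a
  simp only [states, Set.mem_ofPred_eq, Prod.mk.injEq, afterPhase] at ha ⊢
  split_ifs <;> simp <;> omega

/-- The states that can be reached from `a` by at most one transition. -/
def targets (k l : ℕ) (a : ℕ × ℕ) : Finset (ℕ × ℕ) :=
  insert a (insert (afterPhase k a) ((Finset.Icc 1 l).image (afterArrival k a)))

lemma targets_subset {k l : ℕ} (hk : 1 ≤ k) {a : ℕ × ℕ} (ha : a ∈ states k) :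
    ∀ b ∈ targets k l a, b ∈ states k := by
  intro b hb
  simp only [targets, Finset.mem_insert, Finset.mem_image, Finset.mem_Icc] at hb
  rcases hb with rfl | rfl | ⟨m, hm, rfl⟩
  · exact ha
  · exact afterPhase_mem hk ha
  · exact afterArrival_mem hk ha hm.1

/-- The generator of the queue, acting on complex functions of the state. -/
noncomputable def generator (k l : ℕ) (lam : ℕ → ℝ) (μ : ℝ) (φ : ℕ × ℕ → ℂ) (a : ℕ × ℕ) : ℂ :=
  (∑ m ∈ Finset.Icc 1 l, ((totalRate l lam * c l lam m : ℝ) : ℂ) * (φ (afterArrival k a m) - φ a))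
    + if a.1 = 0 then 0 else ((k * μ : ℝ) : ℂ) * (φ (afterPhase k a) - φ a)

/-- No transition of positive rate returns to its starting state, so the case distinction `b = a`
can be dropped and the rates become a combination of point masses, easy to sum against `φ`. -/
lemma rate_eq {k l : ℕ} {lam : ℕ → ℝ} {μ : ℝ} {a : ℕ × ℕ} (ha : a ∈ states k) (b : ℕ × ℕ) :
    rate k l lam μ a b =
      (∑ m ∈ Finset.Icc 1 l, if b = afterArrival k a m then totalRate l lam * c l lam m else 0)
      + (if b = afterPhase k a then (if a.1 = 0 then 0 else (k : ℝ) * μ) else 0)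
      - (if b = a then totalRate l lam + (if a.1 = 0 then 0 else (k : ℝ) * μ) else 0) := by
  unfold rate
  by_cases hb : b = a
  · subst hb
    have h1 : (∑ m ∈ Finset.Icc 1 l,
        if b = afterArrival k b m then totalRate l lam * c l lam m else 0) = 0 :=
      Finset.sum_eq_zero fun m hm => if_neg (afterArrival_ne b (Finset.mem_Icc.1 hm).1)
    by_cases h0 : b.1 = 0
    · simp [h1, h0]
    · simp [h1, h0, afterPhase_ne ha h0]
  · by_cases h0 : a.1 = 0 <;> simp [hb, h0]

lemma sum_rate_mul {k l : ℕ} {lam : ℕ → ℝ} {μ : ℝ} (h : totalRate l lam ≠ 0) {a : ℕ × ℕ}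
    (ha : a ∈ states k) (φ : ℕ × ℕ → ℂ) :
    ∑ b ∈ targets k l a, (rate k l lam μ a b : ℂ) * φ b = generator k l lam μ φ a := by
  have hA : ∀ m ∈ Finset.Icc 1 l, afterArrival k a m ∈ targets k l a := fun m hm => by
    simp only [targets, Finset.mem_insert, Finset.mem_image]
    exact Or.inr (Or.inr ⟨m, hm, rfl⟩)
  have hP : afterPhase k a ∈ targets k l a := by simp [targets]
  have ha' : a ∈ targets k l a := by simp [targets]
  have hs : (∑ m ∈ Finset.Icc 1 l, ((totalRate l lam * c l lam m : ℝ) : ℂ)) = totalRate l lam := by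
    rw [← Complex.ofReal_sum, sum_totalRate_mul_c h]
  have h1 : ∑ b ∈ targets k l a, ∑ m ∈ Finset.Icc 1 l,
      (((if b = afterArrival k a m then totalRate l lam * c l lam m else 0 : ℝ)) : ℂ) * φ b
      = ∑ m ∈ Finset.Icc 1 l,
        ((totalRate l lam * c l lam m : ℝ) : ℂ) * φ (afterArrival k a m) := by
    rw [Finset.sum_comm]
    refine Finset.sum_congr rfl fun m hm => ?_
    rw [Finset.sum_eq_single_of_mem _ (hA m hm)]
    · simp
    · intro b _ hb; simp [hb]
  have h2 : ∀ (d : ℕ × ℕ) (r : ℝ), d ∈ targets k l a → ∑ b ∈ targets k l a,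
      (((if b = d then r else 0 : ℝ)) : ℂ) * φ b = (r : ℂ) * φ d := by
    intro d r hd
    rw [Finset.sum_eq_single_of_mem _ hd]
    · simp
    · intro b _ hb; simp [hb]
  simp only [rate_eq ha, Complex.ofReal_sub, Complex.ofReal_add, Complex.ofReal_sum, sub_mul,
    add_mul, Finset.sum_mul, Finset.sum_add_distrib, Finset.sum_sub_distrib]
  rw [h1, h2 _ _ hP, h2 _ _ ha']
  simp only [generator, mul_sub, Finset.sum_sub_distrib, ← Finset.sum_mul, hs]
  split_ifs <;> push_cast <;> ring

lemma sum_rate {k l : ℕ} {lam : ℕ → ℝ} {μ : ℝ} (h : totalRate l lam ≠ 0) {a : ℕ × ℕ}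
    (ha : a ∈ states k) : ∑ b ∈ targets k l a, rate k l lam μ a b = 0 := by
  have := sum_rate_mul (μ := μ) h ha (fun _ => 1)
  simp only [generator, mul_one, sub_self, mul_zero, Finset.sum_const_zero, ite_self,
    add_zero] at this
  exact_mod_cast this

/-- The monomial that a state contributes to the generating function. -/
noncomputable def monomial (k : ℕ) (x : ℂ) (a : ℕ × ℕ) : ℂ := x ^ ((a.1 - 1) * k + a.2)

lemma norm_monomial_le {k : ℕ} {x : ℂ} (hx : ‖x‖ ≤ 1) (a : ℕ × ℕ) : ‖monomial k x a‖ ≤ 1 := by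
  rw [monomial, norm_pow]
  exact pow_le_one₀ (norm_nonneg _) hx

/-- An arrival of `m` customers multiplies the monomial by `x ^ (m * k)` and a completed phase
divides it by `x`. The factor `x` on the left avoids the division, so `x = 0` is covered. The last
term corrects for the empty state, where no phase can be completed. -/
lemma mul_generator_monomial {k l : ℕ} {lam : ℕ → ℝ} {μ : ℝ} (h : totalRate l lam ≠ 0) {a : ℕ × ℕ}
    (ha : a ∈ states k) (x : ℂ) :
    x * generator k l lam μ (monomial k x) a =
      ((k : ℂ) * (μ : ℂ) * (1 - x)
        - (totalRate l lam : ℂ) * x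
          * (1 - ∑ m ∈ Finset.Icc 1 l, (c l lam m : ℂ) * x ^ (m * k))) * monomial k x a
      - (k : ℂ) * (μ : ℂ) * (1 - x) * (if a = (0, 0) then 1 else 0) := by
  have harr : ∀ m ∈ Finset.Icc 1 l,
      monomial k x (afterArrival k a m) = x ^ (m * k) * monomial k x a := by
    intro m hm
    have hm1 := (Finset.mem_Icc.1 hm).1
    obtain ⟨n, s⟩ := a
    simp only [states, Set.mem_ofPred_eq, Prod.mk.injEq] at ha
    simp only [monomial, afterArrival]
    rw [← pow_add]
    congr 1
    obtain ⟨j, rfl⟩ : ∃ j, m = j + 1 := ⟨m - 1, by omega⟩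
    -- In the empty state, truncated subtraction gives exponent `0`; the arrival leads to `(m, k)`,
    -- with exponent `(m-1)k + k = mk`.
    rcases ha with ⟨rfl, rfl⟩ | ⟨hn, _⟩
    · simp; ring
    · obtain ⟨i, rfl⟩ : ∃ i, n = i + 1 := ⟨n - 1, by omega⟩
      simp only [Nat.add_eq_zero_iff, one_ne_zero, and_false, if_false, Nat.add_sub_cancel]
      rw [show i + 1 + (j + 1) - 1 = i + (j + 1) by omega]
      ring
  have hsum : ∑ m ∈ Finset.Icc 1 l, ((totalRate l lam * c l lam m : ℝ) : ℂ)
      * (monomial k x (afterArrival k a m) - monomial k x a)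
      = - (totalRate l lam : ℂ) * (1 - ∑ m ∈ Finset.Icc 1 l, (c l lam m : ℂ) * x ^ (m * k))
        * monomial k x a := by
    have hs : (∑ m ∈ Finset.Icc 1 l, ((totalRate l lam * c l lam m : ℝ) : ℂ))
        = totalRate l lam := by
      rw [← Complex.ofReal_sum, sum_totalRate_mul_c h]
    have : ∀ m ∈ Finset.Icc 1 l, ((totalRate l lam * c l lam m : ℝ) : ℂ)
        * (monomial k x (afterArrival k a m) - monomial k x a)
        = (totalRate l lam : ℂ) * ((c l lam m : ℂ) * x ^ (m * k)) * monomial k x a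
          - ((totalRate l lam * c l lam m : ℝ) : ℂ) * monomial k x a := by
      intro m hm
      rw [harr m hm]; push_cast; ring
    rw [Finset.sum_congr rfl this, Finset.sum_sub_distrib, ← Finset.sum_mul, ← Finset.sum_mul,
      ← Finset.mul_sum, hs]
    ring
  have hphase : a.1 ≠ 0 → x * monomial k x (afterPhase k a) = monomial k x a := by
    intro h0
    obtain ⟨n, s⟩ := a
    simp only [states, Set.mem_ofPred_eq, Prod.mk.injEq] at ha h0
    simp only [monomial, afterPhase]
    rw [← pow_succ']
    congr 1
    obtain ⟨i, rfl⟩ : ∃ i, n = i + 1 := ⟨n - 1, by omega⟩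
    split_ifs with h1 h2
    · simp at h2; simp [h1, h2]
    · obtain ⟨j, rfl⟩ : ∃ j, i = j + 1 := ⟨i - 1, by omega⟩
      simp [h1]; ring
    · simp only [Nat.add_sub_cancel]; omega
  rw [generator, hsum]
  by_cases h0 : a.1 = 0
  · have ha0 : a = (0, 0) := by
      rcases ha with ha | ha
      · exact ha
      · omega
    subst ha0
    simp [monomial]; ring
  · have ha0 : a ≠ (0, 0) := by rintro rfl; exact h0 rfl
    rw [if_neg h0, if_neg ha0]
    have := hphase h0
    push_cast
    linear_combination ((k : ℂ) * μ) * this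

/-! ### From right derivatives to derivatives -/

section Analysis

/-- A continuous function with continuous right derivative on a half-line is differentiable. -/
lemma hasDerivWithinAt_Ici_of_right {f g : ℝ → ℂ} (hf : ContinuousOn f (Set.Ici 0))
    (hg : ContinuousOn g (Set.Ici 0))
    (h : ∀ t, 0 ≤ t → HasDerivWithinAt f (g t) (Set.Ici t) t) {t : ℝ} (ht : 0 ≤ t) :
    HasDerivWithinAt f (g t) (Set.Ici 0) t := by
  -- Extending `g` by a constant to the left of `0` makes the primitive differentiable on the whole
  -- line, endpoint included.
  set G : ℝ → ℂ := fun u => g (max 0 u) with hG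
  have hGc : Continuous G := by
    rw [← continuousOn_univ]
    exact hg.comp (by fun_prop) fun u _ => le_max_left 0 u
  set F : ℝ → ℂ := fun u => f 0 + ∫ s in (0 : ℝ)..u, G s with hF
  have hFd : ∀ u, HasDerivAt F (G u) u := fun u =>
    (intervalIntegral.integral_hasDerivAt_right (hGc.intervalIntegrable _ _)
      (hGc.stronglyMeasurableAtFilter _ _) hGc.continuousAt).const_add _
  have hGg : ∀ u, 0 ≤ u → G u = g u := fun u hu => by simp [hG, hu]
  have heq : ∀ u ∈ Set.Ici (0 : ℝ), f u = F u := by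
    intro u hu
    refine eq_of_has_deriv_right_eq (f' := g) (a := 0) (b := u) (fun y hy => h y hy.1)
      (fun y hy => ?_) (hf.mono Set.Icc_subset_Ici_self)
      (fun y _ => (hFd y).continuousAt.continuousWithinAt) (by simp [hF]) u ⟨hu, le_rfl⟩
    have := (hFd y).hasDerivWithinAt (s := Set.Ici y)
    rwa [hGg y hy.1] at this
  have := (hFd t).hasDerivWithinAt (s := Set.Ici 0)
  rw [hGg t ht] at this
  exact this.congr heq (heq t ht)

end Analysis

/-! ### Uniform bound on the probability of leaving a state -/

section Dynamics

variable {Ω : Type*} [MeasurableSpace Ω] {P : Measure Ω} {k l : ℕ} {lam : ℕ → ℝ} {μ : ℝ} {Q : ℝ → Ω → ℕ × ℕ}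

lemma IsErlangQueue.measurableSet (hQ : IsErlangQueue P k l lam μ Q) {t : ℝ} (ht : 0 ≤ t)
    (S : Set (ℕ × ℕ)) : MeasurableSet (Q t ⁻¹' S) :=
  hQ.measurable t ht S.to_countable.measurableSet

lemma IsErlangQueue.measure_eq_zero (hQ : IsErlangQueue P k l lam μ Q) {t : ℝ} (ht : 0 ≤ t)
    {a : ℕ × ℕ} (ha : a ∉ states k) : P (Q t ⁻¹' {a}) = 0 := by
  refine measure_mono_null ?_ (ae_iff.1 (hQ.mem_states t ht))
  rintro ω rfl
  exact ha

variable [IsProbabilityMeasure P]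

lemma measureReal_inter_eq (s t : Set Ω) (hs : MeasurableSet s) :
    P.real (s ∩ t) = P.real s * (cond P s).real t := by
  rw [measureReal_def, ← cond_mul_eq_inter hs t P, ENNReal.toReal_mul, mul_comm]
  rfl

/-- The largest total rate of leaving a state. -/
noncomputable def maxRate (k l : ℕ) (lam : ℕ → ℝ) (μ : ℝ) : ℝ := totalRate l lam + k * μ

lemma rate_self_ge (hμ : 0 ≤ μ) (a : ℕ × ℕ) : - maxRate k l lam μ ≤ rate k l lam μ a a := by
  have : 0 ≤ (k : ℝ) * μ := by positivity
  unfold rate maxRate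
  rw [if_pos rfl]
  split_ifs <;> linarith

/-- The probability of finding the process in `a` at all times `t, t + d, …, t + j d`. -/
lemma IsErlangQueue.pow_mul_le (hQ : IsErlangQueue P k l lam μ Q) {a : ℕ × ℕ} {t d y : ℝ}
    (ht : 0 ≤ t) (hd : 0 ≤ d) (hy : 0 ≤ y)
    (hstep : ∀ u, 0 ≤ u → P (Q u ⁻¹' {a}) ≠ 0 →
      y ≤ (cond P (Q u ⁻¹' {a})).real (Q (u + d) ⁻¹' {a})) (j : ℕ) :
    y ^ j * P.real (Q t ⁻¹' {a}) ≤
      P.real (Q (t + j * d) ⁻¹' {a} ∩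
        ⋂ u ∈ (Finset.range (j + 1)).image (fun i : ℕ => t + i * d), Q u ⁻¹' {a}) := by
  induction j with
  | zero => simp
  | succ j ih =>
    set I := (Finset.range (j + 1)).image (fun i : ℕ => t + i * d)
    set E := Q (t + j * d) ⁻¹' {a} ∩ ⋂ u ∈ I, Q u ⁻¹' {a} with hE
    have hI : ∀ u ∈ I, 0 ≤ u ∧ u ≤ t + j * d := by
      intro u hu
      obtain ⟨i, hi, rfl⟩ := Finset.mem_image.1 hu
      have : (i : ℝ) ≤ j := by exact_mod_cast Nat.lt_succ_iff.1 (Finset.mem_range.1 hi)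
      exact ⟨by positivity, by gcongr⟩
    have htj : 0 ≤ t + j * d := by positivity
    have hEm : MeasurableSet E := (hQ.measurableSet htj _).inter
      (Finset.measurableSet_biInter _ fun u hu => hQ.measurableSet (hI u hu).1 _)
    have hsub : E ∩ Q (t + j * d + d) ⁻¹' {a} ⊆ Q (t + (j + 1 : ℕ) * d) ⁻¹' {a} ∩
        ⋂ u ∈ (Finset.range (j + 1 + 1)).image (fun i : ℕ => t + i * d), Q u ⁻¹' {a} := by
      rintro ω ⟨⟨_, h2⟩, h3⟩
      have e : t + (j + 1 : ℕ) * d = t + j * d + d := by push_cast; ring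
      rw [e]
      refine ⟨h3, ?_⟩
      simp only [Set.mem_iInter] at h2 ⊢
      intro u hu
      rw [Finset.range_add_one, Finset.image_insert, Finset.mem_insert] at hu
      rcases hu with rfl | hu
      · rw [e]; exact h3
      · exact h2 u hu
    refine le_trans ?_ (measureReal_mono hsub)
    rw [measureReal_inter_eq _ _ hEm]
    by_cases h0 : P E = 0
    · have : P.real E = 0 := by simp [measureReal_def, h0]
      rw [this] at ih ⊢
      rw [pow_succ']
      nlinarith
    · have h1 : P (Q (t + j * d) ⁻¹' {a}) ≠ 0 := fun h => h0 (measure_mono_null Set.inter_subset_left h)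
      have h2 := hstep _ htj h1
      -- Given the whole record of visits to `a`, the chance of staying one more step equals the
      -- chance given the present alone, which `hstep` bounds.
      have h3 := hQ.markov (t + j * d) d htj hd I hI (fun _ => a) a a h0
      have h4 : (cond P E).real (Q (t + j * d + d) ⁻¹' {a})
          = (cond P (Q (t + j * d) ⁻¹' {a})).real (Q (t + j * d + d) ⁻¹' {a}) :=
        congrArg ENNReal.toReal h3
      rw [h4]
      calc y ^ (j + 1) * P.real (Q t ⁻¹' {a}) = (y ^ j * P.real (Q t ⁻¹' {a})) * y := by ring
        _ ≤ _ := mul_le_mul ih h2 hy measureReal_nonneg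

/-- In time `h`, a state is left with probability at most `h` times the maximal rate. -/
lemma IsErlangQueue.stay_ge (hQ : IsErlangQueue P k l lam μ Q) (hμ : 0 ≤ μ) {t h : ℝ}
    (ht : 0 ≤ t) (hh : 0 ≤ h) {a : ℕ × ℕ} (ha : a ∈ states k) :
    (1 - maxRate k l lam μ * h) * P.real (Q t ⁻¹' {a}) ≤
      P.real (Q t ⁻¹' {a} ∩ Q (t + h) ⁻¹' {a}) := by
  set q := maxRate k l lam μ
  rcases hh.eq_or_lt with rfl | hh
  · simp
  have key : ∀ ε : ℝ, 0 < ε → (1 - (q + ε) * h) * P.real (Q t ⁻¹' {a}) ≤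
      P.real (Q t ⁻¹' {a} ∩ Q (t + h) ⁻¹' {a}) := by
    intro ε hε
    obtain ⟨δ, hδ, H⟩ := hQ.infinitesimal a ha a ha ε hε
    -- The first bound makes each step `h / n` shorter than `δ`, which serves all times at once; the
    -- second keeps `1 - (q + ε) * (h / n)` nonnegative.
    obtain ⟨n, hn⟩ := exists_nat_gt (max (h / δ) (|q + ε| * h))
    have hn1 := (le_max_left _ _).trans_lt hn
    have hn2 := (le_max_right _ _).trans_lt hn
    have hn0 : (0 : ℝ) < n := (by positivity : 0 ≤ h / δ).trans_lt hn1
    have hd : 0 < h / n := by positivity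
    have hdδ : h / n < δ := by
      rw [div_lt_iff₀ hδ] at hn1
      rw [div_lt_iff₀ hn0]; linarith
    have hy : (q + ε) * (h / n) ≤ 1 := by
      rw [← mul_div_assoc, div_le_one hn0]
      nlinarith [le_abs_self (q + ε)]
    have hstep : ∀ u, 0 ≤ u → P (Q u ⁻¹' {a}) ≠ 0 → 1 - (q + ε) * (h / n) ≤
        (cond P (Q u ⁻¹' {a})).real (Q (u + h / n) ⁻¹' {a}) := by
      intro u hu hu0
      have h1 := (abs_le.1 (H u (h / n) hu hd hdδ hu0)).1
      have h2 : -q ≤ rate k l lam μ a a := rate_self_ge hμ a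
      rw [if_pos rfl] at h1
      nlinarith
    have h1 := hQ.pow_mul_le ht hd.le (by linarith) hstep n
    -- Bernoulli's inequality makes the bound independent of `n`, hence of `δ`.
    have h2 : 1 - (q + ε) * h ≤ (1 - (q + ε) * (h / n)) ^ n := by
      have := one_add_mul_le_pow (a := -((q + ε) * (h / n))) (by linarith) n
      rw [← sub_eq_add_neg] at this
      refine le_trans (le_of_eq ?_) this
      field_simp
      ring
    have e : t + n * (h / n) = t + h := by field_simp
    rw [e] at h1
    refine (mul_le_mul_of_nonneg_right h2 measureReal_nonneg).trans (h1.trans ?_)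
    refine measureReal_mono ?_
    rintro ω ⟨hω1, hω2⟩
    refine ⟨?_, hω1⟩
    simp only [Set.mem_iInter] at hω2
    exact hω2 t (Finset.mem_image.2 ⟨0, by simp, by simp⟩)
  have hlim : Tendsto (fun ε : ℝ => (1 - (q + ε) * h) * P.real (Q t ⁻¹' {a})) (𝓝[>] 0)
      (𝓝 ((1 - (q + 0) * h) * P.real (Q t ⁻¹' {a}))) :=
    (Continuous.tendsto (by fun_prop) 0).mono_left nhdsWithin_le_nhds
  rw [add_zero] at hlim
  exact le_of_tendsto hlim (eventually_mem_nhdsWithin.mono fun ε hε => key ε hε)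

/-- Complement of `stay_ge`; outside `states k` both sides vanish. The constant does not depend on
`a`, so the bound can be summed over all states. -/
lemma IsErlangQueue.leave_le (hQ : IsErlangQueue P k l lam μ Q) (hμ : 0 ≤ μ) {t h : ℝ}
    (ht : 0 ≤ t) (hh : 0 ≤ h) (a : ℕ × ℕ) :
    P.real (Q t ⁻¹' {a} ∩ Q (t + h) ⁻¹' {a}ᶜ) ≤ maxRate k l lam μ * h * P.real (Q t ⁻¹' {a}) := by
  by_cases ha : a ∈ states k
  · have h1 := hQ.stay_ge hμ ht hh ha
    have h2 := measureReal_inter_add_sdiff (μ := P) (s := Q t ⁻¹' {a})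
      (hQ.measurableSet (add_nonneg ht hh) {a})
    rw [Set.preimage_compl, ← Set.sdiff_eq]
    linarith
  · have h0 := hQ.measure_eq_zero ht ha
    have h1 : P (Q t ⁻¹' {a} ∩ Q (t + h) ⁻¹' {a}ᶜ) = 0 := measure_mono_null Set.inter_subset_left h0
    simp only [measureReal_def, h0, h1, ENNReal.toReal_zero, mul_zero, le_refl]

end Dynamics

/-! ### Increments of expectations of bounded functions -/

section Expectation

variable {Ω : Type*} [MeasurableSpace Ω] {P : Measure Ω} {k l : ℕ} {lam : ℕ → ℝ} {μ : ℝ} {Q : ℝ → Ω → ℕ × ℕ}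

lemma IsErlangQueue.hasSum_setIntegral (hQ : IsErlangQueue P k l lam μ Q) {t : ℝ} (ht : 0 ≤ t)
    {f : Ω → ℂ} (hf : Integrable f P) :
    HasSum (fun a => ∫ ω in Q t ⁻¹' {a}, f ω ∂P) (∫ ω, f ω ∂P) := by
  have hU : (⋃ a : ℕ × ℕ, Q t ⁻¹' {a}) = Set.univ := by
    ext ω; simp
  have := hasSum_integral_iUnion (μ := P) (f := f) (s := fun a : ℕ × ℕ => Q t ⁻¹' {a})
    (fun a => hQ.measurableSet ht {a})
    (fun a b hab => Disjoint.preimage _ (by simpa using hab)) (by rw [hU]; exact hf.integrableOn)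
  rwa [hU, setIntegral_univ] at this

lemma IsErlangQueue.setIntegral_fiber (hQ : IsErlangQueue P k l lam μ Q) {t : ℝ} (ht : 0 ≤ t)
    (φ : ℕ × ℕ → ℂ) (a : ℕ × ℕ) :
    ∫ ω in Q t ⁻¹' {a}, φ (Q t ω) ∂P = P.real (Q t ⁻¹' {a}) * φ a := by
  rw [setIntegral_congr_fun (g := fun _ => φ a) (hQ.measurableSet ht {a})
    (fun ω hω => by rw [show Q t ω = a from hω]), setIntegral_const]
  simp

variable [IsProbabilityMeasure P]

lemma IsErlangQueue.integrable (hQ : IsErlangQueue P k l lam μ Q) {t C : ℝ} (ht : 0 ≤ t)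
    {φ : ℕ × ℕ → ℂ} (hφ : ∀ a, ‖φ a‖ ≤ C) : Integrable (fun ω => φ (Q t ω)) P :=
  Integrable.of_bound ((measurable_of_countable φ).comp (hQ.measurable t ht)).aestronglyMeasurable
    C (ae_of_all _ fun _ => hφ _)

lemma IsErlangQueue.hasSum_law (hQ : IsErlangQueue P k l lam μ Q) {t C : ℝ} (ht : 0 ≤ t)
    {φ : ℕ × ℕ → ℂ} (hφ : ∀ a, ‖φ a‖ ≤ C) :
    HasSum (fun a => (P.real (Q t ⁻¹' {a}) : ℂ) * φ a) (∫ ω, φ (Q t ω) ∂P) := by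
  simpa only [hQ.setIntegral_fiber ht] using hQ.hasSum_setIntegral ht (hQ.integrable ht hφ)

lemma IsErlangQueue.hasSum_prob (hQ : IsErlangQueue P k l lam μ Q) {t : ℝ} (ht : 0 ≤ t) :
    HasSum (fun a => P.real (Q t ⁻¹' {a})) 1 := by
  have h := hQ.hasSum_law (C := 1) (φ := fun _ => 1) ht (by simp)
  simp only [mul_one, integral_const, probReal_univ, one_smul] at h
  rw [← Complex.ofReal_one] at h
  exact Complex.hasSum_ofReal.1 h

lemma norm_setIntegral_comp_le {Y : Ω → ℕ × ℕ} {C : ℝ}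
    {A : Set Ω} (hA : MeasurableSet A) {S : Set (ℕ × ℕ)} {ψ : ℕ × ℕ → ℂ} (hψ : ∀ b, ‖ψ b‖ ≤ C)
    (hS : ∀ b ∈ S, ψ b = 0) :
    ‖∫ ω in A, ψ (Y ω) ∂P‖ ≤ C * P.real (A ∩ Y ⁻¹' Sᶜ) := by
  rw [setIntegral_eq_of_subset_of_forall_sdiff_eq_zero (s := A ∩ Y ⁻¹' Sᶜ) hA
    Set.inter_subset_left]
  · exact norm_setIntegral_le_of_norm_le_const (measure_lt_top _ _) fun ω _ => hψ _
  · rintro ω ⟨h1, h2⟩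
    refine hS _ (by_contra fun h => h2 ⟨h1, h⟩)

/-- The part of the increment of `E φ(Q)` that comes from the paths in `a` at time `t`. -/
noncomputable def increment (P : Measure Ω) (Q : ℝ → Ω → ℕ × ℕ) (φ : ℕ × ℕ → ℂ) (t h : ℝ)
    (a : ℕ × ℕ) : ℂ :=
  ∫ ω in Q t ⁻¹' {a}, (φ (Q (t + h) ω) - φ a) ∂P

lemma IsErlangQueue.hasSum_increment (hQ : IsErlangQueue P k l lam μ Q) {t h C : ℝ} (ht : 0 ≤ t)
    (hh : 0 ≤ h) {φ : ℕ × ℕ → ℂ} (hφ : ∀ a, ‖φ a‖ ≤ C) :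
    HasSum (increment P Q φ t h) ((∫ ω, φ (Q (t + h) ω) ∂P) - ∫ ω, φ (Q t ω) ∂P) := by
  have h1 := hQ.integrable (add_nonneg ht hh) hφ
  have h2 := hQ.integrable ht hφ
  have := hQ.hasSum_setIntegral ht (h1.sub h2)
  simp only [Pi.sub_apply] at this
  rw [integral_sub h1 h2] at this
  convert this using 2 with a
  exact setIntegral_congr_fun (hQ.measurableSet ht {a})
    fun ω hω => by rw [show Q t ω = a from hω]

/-- The integrand vanishes on paths that are again in `a` at time `t + h` and is at most `2 * C`
elsewhere. After division by `h` this is a majorant summable over `a`. -/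
lemma IsErlangQueue.norm_increment_le (hQ : IsErlangQueue P k l lam μ Q) (hμ : 0 ≤ μ) {t h C : ℝ}
    (ht : 0 ≤ t) (hh : 0 ≤ h) {φ : ℕ × ℕ → ℂ} (hφ : ∀ a, ‖φ a‖ ≤ C) (a : ℕ × ℕ) :
    ‖increment P Q φ t h a‖ ≤ h * (2 * C * maxRate k l lam μ * P.real (Q t ⁻¹' {a})) := by
  have hC : 0 ≤ C := (norm_nonneg _).trans (hφ a)
  have h1 := norm_setIntegral_comp_le (P := P) (Y := Q (t + h)) (hQ.measurableSet ht {a}) (S := {a})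
    (ψ := fun b => φ b - φ a) (C := 2 * C)
    (fun b => (norm_sub_le _ _).trans (by linarith [hφ a, hφ b]))
    (by rintro b rfl; exact sub_self _)
  have h2 := mul_le_mul_of_nonneg_left (hQ.leave_le hμ ht hh a) (by linarith : 0 ≤ 2 * C)
  exact h1.trans (h2.trans (le_of_eq (by ring)))

/-- For bounded `φ`, the function `t ↦ E φ(Q t)` is Lipschitz. -/
lemma IsErlangQueue.continuousOn_integral (hQ : IsErlangQueue P k l lam μ Q) (hμ : 0 ≤ μ) {C : ℝ}
    {φ : ℕ × ℕ → ℂ} (hφ : ∀ a, ‖φ a‖ ≤ C) :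
    ContinuousOn (fun t => ∫ ω, φ (Q t ω) ∂P) (Set.Ici 0) := by
  have key : ∀ t h : ℝ, 0 ≤ t → 0 ≤ h →
      ‖(∫ ω, φ (Q (t + h) ω) ∂P) - ∫ ω, φ (Q t ω) ∂P‖ ≤ 2 * C * maxRate k l lam μ * h := by
    intro t h ht hh
    have h2 := ((hQ.hasSum_prob ht).mul_left (2 * C * maxRate k l lam μ)).mul_left h
    have := (hQ.hasSum_increment ht hh hφ).norm_le_of_bounded h2
      (fun a => hQ.norm_increment_le hμ ht hh hφ a)
    linarith
  refine (LipschitzOnWith.of_dist_le_mul (K := (2 * C * maxRate k l lam μ).toNNReal)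
    fun s hs t ht => ?_).continuousOn
  have hle := Real.le_coe_toNNReal (2 * C * maxRate k l lam μ)
  wlog hst : s ≤ t generalizing s t
  · rw [dist_comm, dist_comm s t]
    exact this t ht s hs (le_of_not_ge hst)
  have := key s (t - s) hs (sub_nonneg.2 hst)
  rw [add_sub_cancel] at this
  rw [dist_comm, dist_eq_norm, dist_comm, Real.dist_eq, abs_of_nonneg (sub_nonneg.2 hst)]
  exact this.trans (mul_le_mul_of_nonneg_right hle (sub_nonneg.2 hst))

lemma IsErlangQueue.tendsto_joint (hQ : IsErlangQueue P k l lam μ Q) {t : ℝ} (ht : 0 ≤ t)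
    {a b : ℕ × ℕ} (ha : a ∈ states k) (hb : b ∈ states k) :
    Tendsto (fun h : ℝ => h⁻¹ * (P.real (Q t ⁻¹' {a} ∩ Q (t + h) ⁻¹' {b})
      - P.real (Q t ⁻¹' {a}) * if b = a then 1 else 0)) (𝓝[>] 0)
      (𝓝 (P.real (Q t ⁻¹' {a}) * rate k l lam μ a b)) := by
  by_cases h0 : P (Q t ⁻¹' {a}) = 0
  · have h1 : ∀ B, P (Q t ⁻¹' {a} ∩ B) = 0 := fun B => measure_mono_null Set.inter_subset_left h0
    simp [measureReal_def, h0, h1]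
  · simp only [measureReal_inter_eq _ _ (hQ.measurableSet ht {a}), ← mul_sub]
    have key : Tendsto (fun h : ℝ => h⁻¹ * ((cond P (Q t ⁻¹' {a})).real (Q (t + h) ⁻¹' {b})
        - if b = a then 1 else 0)) (𝓝[>] 0) (𝓝 (rate k l lam μ a b)) := by
      rw [Metric.tendsto_nhds]
      intro ε hε
      obtain ⟨δ, hδ, H⟩ := hQ.infinitesimal a ha b hb (ε / 2) (half_pos hε)
      filter_upwards [Ioo_mem_nhdsGT hδ] with h hh
      have h1 := H t h ht hh.1 hh.2 h0
      have hpos : 0 < h := hh.1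
      rw [Real.dist_eq]
      rw [show ∀ p i r : ℝ, h⁻¹ * (p - i) - r = h⁻¹ * (p - (i + r * h)) by
        intro p i r; field_simp; ring, abs_mul, abs_of_pos (inv_pos.2 hpos)]
      rw [inv_mul_lt_iff₀ hpos]
      exact h1.trans_lt (by nlinarith)
    refine (key.const_mul (P.real (Q t ⁻¹' {a}))).congr fun h => by ring

lemma IsErlangQueue.joint_compl_targets (hQ : IsErlangQueue P k l lam μ Q) {t h : ℝ} (ht : 0 ≤ t)
    (hh : 0 ≤ h) (a : ℕ × ℕ) (T : Finset (ℕ × ℕ)) :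
    P.real (Q t ⁻¹' {a} ∩ Q (t + h) ⁻¹' (T : Set (ℕ × ℕ))ᶜ) = P.real (Q t ⁻¹' {a})
      - ∑ b ∈ T, P.real (Q t ⁻¹' {a} ∩ Q (t + h) ⁻¹' {b}) := by
  have hth := add_nonneg ht hh
  have h1 := measureReal_inter_add_sdiff (μ := P) (s := Q t ⁻¹' {a})
    (hQ.measurableSet hth (T : Set (ℕ × ℕ)))
  have h2 : Q t ⁻¹' {a} ∩ Q (t + h) ⁻¹' (T : Set (ℕ × ℕ)) =
      ⋃ b ∈ T, Q t ⁻¹' {a} ∩ Q (t + h) ⁻¹' {b} := by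
    ext ω; simp
  rw [h2, measureReal_biUnion_finset] at h1
  · rw [Set.preimage_compl, ← Set.sdiff_eq]; linarith
  · intro b _ b' _ hbb'
    refine Disjoint.mono Set.inter_subset_right Set.inter_subset_right ?_
    exact Disjoint.preimage _ (by simpa using hbb')
  · intro b _
    exact (hQ.measurableSet ht _).inter (hQ.measurableSet hth _)

/-- The hypothesis controls one target state at a time, while the complement of `targets` is
infinite. Since the rates over the finite set `targets` sum to zero, that set already carries all
the mass up to `o(h)`. -/
lemma IsErlangQueue.tendsto_compl_targets (hQ : IsErlangQueue P k l lam μ Q) (hk : 1 ≤ k)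
    (hlam : totalRate l lam ≠ 0) {t : ℝ} (ht : 0 ≤ t) {a : ℕ × ℕ} (ha : a ∈ states k) :
    Tendsto (fun h : ℝ => h⁻¹ * P.real (Q t ⁻¹' {a} ∩
      Q (t + h) ⁻¹' (targets k l a : Set (ℕ × ℕ))ᶜ)) (𝓝[>] 0) (𝓝 0) := by
  have h1 := tendsto_finsetSum (targets k l a) fun b hb =>
    hQ.tendsto_joint ht ha (targets_subset hk ha b hb)
  rw [← Finset.mul_sum, sum_rate hlam ha, mul_zero] at h1
  have h2 := h1.neg
  rw [neg_zero] at h2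
  refine h2.congr' ?_
  filter_upwards [self_mem_nhdsWithin] with h hh
  rw [hQ.joint_compl_targets ht (le_of_lt hh), ← Finset.mul_sum, Finset.sum_sub_distrib,
    ← Finset.mul_sum, Finset.sum_ite_eq']
  simp [targets]
  ring

/-- The function `φ - φ a` is split into its finitely many values on `targets`, where
`tendsto_joint` applies, and a bounded remainder supported off `targets`, where the probability is
`o(h)`. -/
lemma IsErlangQueue.tendsto_increment (hQ : IsErlangQueue P k l lam μ Q) (hk : 1 ≤ k)
    (hlam : totalRate l lam ≠ 0) {t C : ℝ} (ht : 0 ≤ t) {φ : ℕ × ℕ → ℂ} (hφ : ∀ a, ‖φ a‖ ≤ C)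
    {a : ℕ × ℕ} (ha : a ∈ states k) :
    Tendsto (fun h : ℝ => (h : ℂ)⁻¹ * increment P Q φ t h a) (𝓝[>] 0)
      (𝓝 (P.real (Q t ⁻¹' {a}) * generator k l lam μ φ a)) := by
  set T := targets k l a
  set f : ℕ × ℕ → ℂ := fun b => φ b - φ a with hf
  have hfC : ∀ b, ‖f b‖ ≤ 2 * C := fun b =>
    (norm_sub_le _ _).trans (by linarith [hφ a, hφ b])
  have hC : 0 ≤ 2 * C := (norm_nonneg _).trans (hfC a)
  set g : ℕ × ℕ → ℂ := fun b => if b ∈ T then 0 else f b with hg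
  have hgC : ∀ b, ‖g b‖ ≤ 2 * C := fun b => by
    simp only [hg]; split_ifs
    · simpa using hC
    · exact hfC b
  have hfa : f a = 0 := sub_self _
  have hdec : ∀ h : ℝ, 0 ≤ h → increment P Q φ t h a =
      (∑ b ∈ T, (P.real (Q t ⁻¹' {a} ∩ Q (t + h) ⁻¹' {b}) : ℂ) * f b)
        + ∫ ω in Q t ⁻¹' {a}, g (Q (t + h) ω) ∂P := by
    intro h hh
    have hth := add_nonneg ht hh
    have hpt : ∀ b, f b = (∑ d ∈ T, (if b = d then f d else 0)) + g b := by
      intro b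
      rw [Finset.sum_ite_eq]
      simp only [hg]; split_ifs <;> simp
    have hint : ∀ d, Integrable (fun ω => if Q (t + h) ω = d then f d else 0) P := fun d =>
      hQ.integrable hth (C := 2 * C) (φ := fun b => if b = d then f d else 0) fun b => by
        split_ifs
        · exact hfC d
        · simpa using hC
    have hval : ∀ d, ∫ ω in Q t ⁻¹' {a}, (if Q (t + h) ω = d then f d else 0) ∂P
        = (P.real (Q t ⁻¹' {a} ∩ Q (t + h) ⁻¹' {d}) : ℂ) * f d := by
      intro d
      have e : (fun ω => if Q (t + h) ω = d then f d else 0)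
          = (Q (t + h) ⁻¹' {d}).indicator (fun _ => f d) := by
        ext ω; simp [Set.indicator]
      rw [e, setIntegral_indicator (hQ.measurableSet hth {d}), setIntegral_const]
      simp
    calc increment P Q φ t h a = ∫ ω in Q t ⁻¹' {a}, f (Q (t + h) ω) ∂P := rfl
      _ = ∫ ω in Q t ⁻¹' {a}, ((∑ d ∈ T, (if Q (t + h) ω = d then f d else 0))
            + g (Q (t + h) ω)) ∂P := by
          refine integral_congr_ae (ae_of_all _ fun ω => hpt _)
      _ = _ := by
          rw [integral_add (integrable_finsetSum _ fun d _ => (hint d).integrableOn)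
            (hQ.integrable hth hgC).integrableOn,
            integral_finsetSum _ fun d _ => (hint d).integrableOn]
          simp only [hval]
  have hmain : Tendsto (fun h : ℝ => ∑ b ∈ T,
      ((h⁻¹ * (P.real (Q t ⁻¹' {a} ∩ Q (t + h) ⁻¹' {b})
      - P.real (Q t ⁻¹' {a}) * if b = a then 1 else 0) : ℝ) : ℂ) * f b) (𝓝[>] 0)
      (𝓝 (∑ b ∈ T, ((P.real (Q t ⁻¹' {a}) * rate k l lam μ a b : ℝ) : ℂ) * f b)) := by
    refine tendsto_finsetSum _ fun b hb => Tendsto.mul_const _ ?_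
    exact (Complex.continuous_ofReal.tendsto _).comp
      (hQ.tendsto_joint ht ha (targets_subset hk ha b hb))
  have hrem : Tendsto (fun h : ℝ => (h : ℂ)⁻¹ * ∫ ω in Q t ⁻¹' {a}, g (Q (t + h) ω) ∂P) (𝓝[>] 0)
      (𝓝 0) := by
    have h1 := (hQ.tendsto_compl_targets hk hlam ht ha).const_mul (2 * C)
    rw [mul_zero] at h1
    refine squeeze_zero_norm' ?_ h1
    filter_upwards [self_mem_nhdsWithin] with h hh
    have hh' : 0 < h := hh
    have h2 := norm_setIntegral_comp_le (P := P) (Y := Q (t + h)) (hQ.measurableSet ht {a}) hgC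
      (S := (T : Set (ℕ × ℕ))) (fun b hb => by
        have : b ∈ T := hb
        simp [hg, this])
    rw [norm_mul, norm_inv, Complex.norm_real, Real.norm_of_nonneg hh'.le, mul_left_comm]
    gcongr
  have hlimit : ∑ b ∈ T, ((P.real (Q t ⁻¹' {a}) * rate k l lam μ a b : ℝ) : ℂ) * f b
      = P.real (Q t ⁻¹' {a}) * generator k l lam μ φ a := by
    -- The generator sees only differences of values, so `φ` may be replaced by `f`.
    have e : generator k l lam μ φ a = generator k l lam μ f a := by
      simp [generator, hf]
    rw [e, ← sum_rate_mul hlam ha, Finset.mul_sum]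
    exact Finset.sum_congr rfl fun b _ => by push_cast; ring
  have := hmain.add hrem
  rw [hlimit, add_zero] at this
  refine this.congr' ?_
  filter_upwards [self_mem_nhdsWithin] with h hh
  rw [hdec h (le_of_lt hh), mul_add, Finset.mul_sum]
  congr 1
  refine Finset.sum_congr rfl fun b _ => ?_
  -- The subtracted indicator matters only at `b = a`, where `f` vanishes.
  by_cases hb : b = a
  · rw [hb, hfa]; simp
  · simp [hb]; ring

end Expectation

/-! ### The forward equation and the generating function -/

section Forward

variable {Ω : Type*} [MeasurableSpace Ω] {P : Measure Ω} [IsProbabilityMeasure P]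
  {k l : ℕ} {lam : ℕ → ℝ} {μ : ℝ} {Q : ℝ → Ω → ℕ × ℕ}

lemma norm_generator_le {φ : ℕ × ℕ → ℂ} {C : ℝ} (hφ : ∀ a, ‖φ a‖ ≤ C) (a : ℕ × ℕ) :
    ‖generator k l lam μ φ a‖ ≤
      (∑ m ∈ Finset.Icc 1 l, |totalRate l lam * c l lam m| * (2 * C)) + |k * μ| * (2 * C) := by
  have h : ∀ b, ‖φ b - φ a‖ ≤ 2 * C := fun b =>
    (norm_sub_le _ _).trans (by linarith [hφ a, hφ b])
  have hC : 0 ≤ 2 * C := (norm_nonneg _).trans (h a)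
  refine (norm_add_le _ _).trans (add_le_add ((norm_sum_le _ _).trans ?_) ?_)
  · refine Finset.sum_le_sum fun m _ => ?_
    rw [norm_mul, Complex.norm_real, Real.norm_eq_abs]
    exact mul_le_mul_of_nonneg_left (h _) (abs_nonneg _)
  · split_ifs
    · rw [norm_zero]; positivity
    · rw [norm_mul, Complex.norm_real, Real.norm_eq_abs]
      exact mul_le_mul_of_nonneg_left (h _) (abs_nonneg _)

/-- The difference quotient is a sum over the state at time `t`; its terms converge by
`tendsto_increment` and are dominated by `norm_increment_le`, so the limit passes inside the sum. -/
lemma IsErlangQueue.hasDerivWithinAt_right (hQ : IsErlangQueue P k l lam μ Q) (hk : 1 ≤ k)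
    (hlam : totalRate l lam ≠ 0) (hμ : 0 ≤ μ) {t C : ℝ} (ht : 0 ≤ t) {φ : ℕ × ℕ → ℂ}
    (hφ : ∀ a, ‖φ a‖ ≤ C) :
    HasDerivWithinAt (fun u => ∫ ω, φ (Q u ω) ∂P) (∫ ω, generator k l lam μ φ (Q t ω) ∂P)
      (Set.Ici t) t := by
  have hlim : Tendsto (fun h : ℝ => ∑' a, (h : ℂ)⁻¹ * increment P Q φ t h a) (𝓝[>] 0)
      (𝓝 (∑' a, (P.real (Q t ⁻¹' {a}) : ℂ) * generator k l lam μ φ a)) := by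
    refine tendsto_tsum_of_dominated_convergence
      ((hQ.hasSum_prob ht).mul_left (2 * C * maxRate k l lam μ)).summable (fun a => ?_) ?_
    · by_cases ha : a ∈ states k
      · exact hQ.tendsto_increment hk hlam ht hφ ha
      · have h0 := hQ.measure_eq_zero ht ha
        simp [increment, setIntegral_measure_zero _ h0, measureReal_def, h0]
    · filter_upwards [self_mem_nhdsWithin] with h hh a
      have hh' : 0 < h := hh
      rw [norm_mul, norm_inv, Complex.norm_real, Real.norm_of_nonneg hh'.le, inv_mul_le_iff₀ hh']
      exact hQ.norm_increment_le hμ ht hh'.le hφ a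
  rw [(hQ.hasSum_law ht (norm_generator_le hφ)).tsum_eq] at hlim
  rw [← hasDerivWithinAt_Ioi_iff_Ici, hasDerivWithinAt_iff_tendsto_slope' (by simp)]
  have hshift : Tendsto (fun y : ℝ => y - t) (𝓝[>] t) (𝓝[>] 0) := by
    refine tendsto_nhdsWithin_iff.2 ⟨?_, ?_⟩
    · exact ((continuous_id.sub continuous_const).tendsto' t 0 (sub_self t)).mono_left nhdsWithin_le_nhds
    · filter_upwards [self_mem_nhdsWithin] with y hy
      exact sub_pos.2 (Set.mem_Ioi.1 hy)
  refine (hlim.comp hshift).congr' ?_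
  filter_upwards [self_mem_nhdsWithin] with y hy
  have hy' : 0 ≤ y - t := (sub_pos.2 (Set.mem_Ioi.1 hy)).le
  have h1 := (hQ.hasSum_increment ht hy' hφ).tsum_eq
  rw [add_sub_cancel] at h1
  simp only [Function.comp_apply]
  rw [tsum_mul_left, h1, slope_def_module, Complex.real_smul, Complex.ofReal_inv]

/-- Kolmogorov's forward equation, tested against a bounded function of the state. -/
theorem IsErlangQueue.hasDerivWithinAt_integral (hQ : IsErlangQueue P k l lam μ Q) (hk : 1 ≤ k)
    (hlam : totalRate l lam ≠ 0) (hμ : 0 ≤ μ) {t C : ℝ} (ht : 0 ≤ t) {φ : ℕ × ℕ → ℂ}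
    (hφ : ∀ a, ‖φ a‖ ≤ C) :
    HasDerivWithinAt (fun u => ∫ ω, φ (Q u ω) ∂P) (∫ ω, generator k l lam μ φ (Q t ω) ∂P)
      (Set.Ici 0) t :=
  -- The generator maps bounded functions to bounded functions, so `continuousOn_integral` also
  -- gives continuity of the right derivative.
  hasDerivWithinAt_Ici_of_right (g := fun t => ∫ ω, generator k l lam μ φ (Q t ω) ∂P)
    (hQ.continuousOn_integral hμ hφ) (hQ.continuousOn_integral hμ (norm_generator_le hφ))
    (fun _ hu => hQ.hasDerivWithinAt_right hk hlam hμ hu hφ) ht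

/-- The queue starts empty almost surely, so conditioning on that event changes nothing. -/
lemma IsErlangQueue.prob_eq (hQ : IsErlangQueue P k l lam μ Q) (a : ℕ × ℕ) (t : ℝ) :
    prob P Q a t = P.real (Q t ⁻¹' {a}) := by
  have h : P (Q 0 ⁻¹' {(0, 0)}) = 1 :=
    (prob_compl_eq_zero_iff (hQ.measurableSet le_rfl _)).1 (ae_iff.1 hQ.start)
  have h' : P.restrict (Q 0 ⁻¹' {(0, 0)}) = P := Measure.restrict_eq_self_of_ae_mem hQ.start
  rw [prob, ProbabilityTheory.cond, h, inv_one, one_smul, h']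

lemma IsErlangQueue.hasSum_genTerm (hQ : IsErlangQueue P k l lam μ Q) {x : ℂ} (hx : ‖x‖ ≤ 1)
    {t : ℝ} (ht : 0 ≤ t) :
    HasSum (genTerm P k Q x t) ((∫ ω, monomial k x (Q t ω) ∂P) - prob P Q (0, 0) t) := by
  have hz : ∀ a, a ∉ states k → (P.real (Q t ⁻¹' {a}) : ℂ) * monomial k x a = 0 := fun a ha => by
    simp [measureReal_def, hQ.measure_eq_zero ht ha]
  set g : ℕ → ℂ := fun n => if n = 0 then (prob P Q (0, 0) t : ℂ) else genTerm P k Q x t (n - 1)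
    with hg
  have h1 : HasSum g (∫ ω, monomial k x (Q t ω) ∂P) := by
    refine (hQ.hasSum_law ht (norm_monomial_le (k := k) hx)).prod_fiberwise fun n => ?_
    rcases n with _ | n
    -- In the row `n = 0` only `(0, 0)` is a state, and its monomial is `1`.
    · have h2 := hasSum_single (f := fun s => (P.real (Q t ⁻¹' {(0, s)}) : ℂ)
        * monomial k x (0, s)) 0 (fun s hs => hz _ (by simp [states, hs]))
      simpa [hg, hQ.prob_eq, monomial] using h2
    · have h2 := hasSum_sum_of_ne_finset_zero (L := .unconditional ℕ) (f := fun s => (P.real (Q t ⁻¹' {(n + 1, s)}) : ℂ)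
        * monomial k x (n + 1, s)) (s := Finset.Icc 1 k)
        (fun s hs => hz _ (by
          rw [Finset.mem_Icc] at hs
          simp only [states, Set.mem_ofPred_eq, Prod.mk.injEq]
          omega))
      convert h2 using 1
      simp only [hg, genTerm, hQ.prob_eq, monomial, Nat.add_sub_cancel]
      exact Finset.sum_congr rfl fun s _ => mul_comm _ _
  -- Removing row `0` shifts the index, matching `genTerm`, whose `n`-th term belongs to `n + 1`
  -- customers.
  have h3 := (hasSum_nat_add_iff' 1).2 h1
  simpa [hg] using h3

lemma IsErlangQueue.genFun_eq (hQ : IsErlangQueue P k l lam μ Q) {x : ℂ} (hx : ‖x‖ ≤ 1)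
    {t : ℝ} (ht : 0 ≤ t) : genFun P k Q x t = ∫ ω, monomial k x (Q t ω) ∂P := by
  rw [genFun, (hQ.hasSum_genTerm hx ht).tsum_eq, add_sub_cancel]

lemma IsErlangQueue.mul_integral_generator (hQ : IsErlangQueue P k l lam μ Q)
    (hlam : totalRate l lam ≠ 0) {x : ℂ} (hx : ‖x‖ ≤ 1) {t : ℝ} (ht : 0 ≤ t) :
    x * ∫ ω, generator k l lam μ (monomial k x) (Q t ω) ∂P =
      ((k : ℂ) * (μ : ℂ) * (1 - x)
        - (totalRate l lam : ℂ) * x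
          * (1 - ∑ m ∈ Finset.Icc 1 l, (c l lam m : ℂ) * x ^ (m * k)))
        * genFun P k Q x t
      - (k : ℂ) * (μ : ℂ) * (1 - x) * (prob P Q (0, 0) t : ℂ) := by
  have hφ := norm_monomial_le (k := k) hx
  have hδ : ∀ a : ℕ × ℕ, ‖(if a = (0, 0) then 1 else 0 : ℂ)‖ ≤ 1 := fun a => by
    split_ifs <;> simp
  have hp : ∫ ω, (if Q t ω = (0, 0) then 1 else 0 : ℂ) ∂P = prob P Q (0, 0) t := by
    rw [← (hQ.hasSum_law (φ := fun a => if a = (0, 0) then 1 else 0) ht hδ).tsum_eq,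
      tsum_eq_single (0, 0) (fun a ha => by simp [ha]), hQ.prob_eq]
    simp
  rw [← integral_const_mul, hQ.genFun_eq hx ht, ← hp, ← integral_const_mul, ← integral_const_mul,
    ← integral_sub ((hQ.integrable ht hφ).const_mul _)
      ((hQ.integrable (φ := fun a => if a = (0, 0) then 1 else 0) ht hδ).const_mul _)]
  refine integral_congr_ae ?_
  filter_upwards [hQ.mem_states t ht] with ω hω
  exact mul_generator_monomial hlam hω x

end Forward
end ErlangQueue

theorem mainTheorem5 {Ω : Type*} [MeasurableSpace Ω] (P : Measure Ω) [IsProbabilityMeasure P]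
    (k l : ℕ) (hk : 1 ≤ k) (hl : 1 ≤ l)
    (lam : ℕ → ℝ) (hlam : ∀ m, 1 ≤ m → m ≤ l → 0 < lam m) (μ : ℝ) (hμ : 0 < μ)
    (Q : ℝ → Ω → ℕ × ℕ) (hQ : ErlangQueue.IsErlangQueue P k l lam μ Q) :
    ∀ x : ℂ, ‖x‖ ≤ 1 →
      (∀ t : ℝ, 0 ≤ t → Summable (ErlangQueue.genTerm P k Q x t)) ∧
      (∀ t : ℝ, 0 ≤ t → ∃ D : ℂ,
        HasDerivWithinAt (fun τ : ℝ => ErlangQueue.genFun P k Q x τ) D (Set.Ici 0) t ∧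
        x * D =
          ((k : ℂ) * (μ : ℂ) * (1 - x)
            - (ErlangQueue.totalRate l lam : ℂ) * x
              * (1 - ∑ m ∈ Finset.Icc 1 l, (ErlangQueue.c l lam m : ℂ) * x ^ (m * k)))
            * ErlangQueue.genFun P k Q x t
          - (k : ℂ) * (μ : ℂ) * (1 - x) * (ErlangQueue.prob P Q (0, 0) t : ℂ)) ∧
      ErlangQueue.genFun P k Q x 0 = 1 := by
  intro x hx
  have hlam0 := (ErlangQueue.totalRate_pos hl hlam).ne'
  refine ⟨fun t ht => (hQ.hasSum_genTerm hx ht).summable, fun t ht => ⟨_, ?_,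
    hQ.mul_integral_generator hlam0 hx ht⟩, ?_⟩
  · exact (hQ.hasDerivWithinAt_integral hk hlam0 hμ.le ht
      (ErlangQueue.norm_monomial_le hx)).congr (fun u hu => hQ.genFun_eq hx hu)
      (hQ.genFun_eq hx ht)
  · rw [hQ.genFun_eq hx le_rfl, integral_congr_ae (g := fun _ => 1)]
    · simp
    · filter_upwards [hQ.start] with ω hω
      simp [hω, ErlangQueue.monomial]
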